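/- Let $m,n\ge 0$. An LCQP-graph $G=(A,b,c,Q,l,u,\circ)$ with $m$ constraints and $n$ variables consists of $A\in\mathbb{R}^{m\times n}$, $b\in\mathbb{R}^m$, $c\in\mathbb{R}^n$, a symmetric positive semidefinite matrix $Q\in\mathbb{R}^{n\times n}$, $l\in(\mathbb{R}\cup\{-\infty\})^n$, $u\in(\mathbb{R}\cup\{+\infty\})^n$ and $\circ\in\{\le,=,\ge\}^m$. It encodes the problem $$\min_{x\in\mathbb{R}^n}\ \tfrac12 x^\top Qx+c^\top x\quad\text{s.t.}\quad Ax\circ b,\ l\le x\le u .$$ Let $\Phi_{\mathrm{obj}}(G)\in\mathbb{R}\cup\{\pm\infty\}$ be the infimum of the objective over the feasible set: it is $+\infty$ if the problem is infeasible, $-\infty$ if it is unbounded, and real exactly when the problem is feasible and bounded. The set $\mathcal{G}^{m,n}$ of all such graphs carries the subspace topology of the product of the spaces of $A,b,c,Q,l,u,\circ$, where Euclidean spaces have the usual topology, $\{\le,=,\ge\}$ is discrete, and $\mathbb{R}\cup\{-\infty\}$ and $\mathbb{R}\cup\{+\infty\}$ are topological disjoint unions. A message-passing GNN consists of a number $L\in\mathbb{N}$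 of layers, finite-dimensional real feature spaces, and continuous maps $f^V_l,f^W_l$ $(0\le l\le L)$, $g^V_l,g^W_l,g^Q_l$ $(1\le l\le L)$ and $r_1$, none of which depends on $m,n$. On input $G$ it computes $$s_i^0=f_0^V(b_i,\circ_i),\qquad t_j^0=f_0^W(c_j,l_j,u_j),$$ then, for $l=1,\dots,L$, $$s_i^l=f_l^V\Big(s_i^{l-1},\sum_{j=1}^n A_{ij}\,g_l^W(t_j^{l-1})\Big),\qquad t_j^l=f_l^W\Big(t_j^{l-1},\sum_{i=1}^m A_{ij}\,g_l^V(s_i^{l-1}),\sum_{j'=1}^n Q_{jj'}\,g_l^Q(t_{j'}^{l-1})\Big),$$ and outputs $F(G)=r_1\big(\sum_i s_i^L,\sum_j t_j^L\big)\in\mathbb{R}$. **Theorem.** Let $\mathbb{P}$ be a Borel regular probability measure on $\mathcal{G}^{m,n}$. 1. For every $\epsilon>0$ there is a message-passing GNN $F_1$ such that $$\mathbb{P}\big[\mathbb{I}_{F_1(G)>1/2}\neq\mathbb{I}_{\Phi_{\mathrm{obj}}(G)\in\mathbb{R}}\big]<\epsilon .$$ 2. If $\mathbb{P}[\Phi_{\mathrm{obj}}(G)\in\mathbb{R}]=1$,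 then for all $\epsilon,\delta>0$ there is a message-passing GNN $F_2$ such that $$\mathbb{P}\big[|F_2(G)-\Phi_{\mathrm{obj}}(G)|>\delta\big]<\epsilon .$$ -/

import Mathlib

open MeasureTheory

/-- The type of a linear constraint: one of `≤`, `=`, `≥`. -/
inductive ConstraintSense : Type
  | le
  | eq
  | ge

/-- The set of constraint types carries the discrete topology. -/
instance ConstraintSense.instTopologicalSpace : TopologicalSpace ConstraintSense := ⊥

instance ConstraintSense.instDiscreteTopology : DiscreteTopology ConstraintSense := ⟨rfl⟩

/-- `a ∘ b` for a constraint type `∘`. -/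
def ConstraintSense.Holds (σ : ConstraintSense) (a b : ℝ) : Prop :=
  match σ with
  | .le => a ≤ b
  | .eq => a = b
  | .ge => a ≥ b

/-- The disjoint union `ℝ ⊔ {-∞}` with its disjoint-union topology; `Sum.inr ()` is `-∞`. -/
abbrev LowerBd : Type := ℝ ⊕ Unit

/-- The disjoint union `ℝ ⊔ {+∞}` with its disjoint-union topology; `Sum.inr ()` is `+∞`. -/
abbrev UpperBd : Type := ℝ ⊕ Unit

/-- `l ≤ x` for `l ∈ ℝ ⊔ {-∞}` and `x ∈ ℝ`. -/
def LowerBd.Holds (l : LowerBd) (x : ℝ) : Prop :=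
  match l with
  | .inl a => a ≤ x
  | .inr _ => True

/-- `x ≤ u` for `u ∈ ℝ ⊔ {+∞}` and `x ∈ ℝ`. -/
def UpperBd.Holds (u : UpperBd) (x : ℝ) : Prop :=
  match u with
  | .inl a => x ≤ a
  | .inr _ => True

/-- An LCQP-graph with `m` constraint nodes and `n` variable nodes. It encodes the problem
`min ½ xᵀ Q x + cᵀ x` subject to `A x ∘ b`, `l ≤ x ≤ u`, with `Q` symmetric positive semidefinite.
`A` and `Q` are the edge weights (weight zero: no edge), `(b i, sense i)` is the feature of the
constraint node `i` and `(c j, l j, u j)` the feature of the variable node `j`. -/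
structure LCQPGraph (m n : ℕ) : Type where
  A : Matrix (Fin m) (Fin n) ℝ
  b : Fin m → ℝ
  c : Fin n → ℝ
  Q : Matrix (Fin n) (Fin n) ℝ
  l : Fin n → LowerBd
  u : Fin n → UpperBd
  sense : Fin m → ConstraintSense
  posSemidef : Q.PosSemidef

namespace LCQPGraph

/-- The tuple `(A, b, c, Q, l, u, ∘)` as a point of the product space. -/
def toProd {m n : ℕ} (G : LCQPGraph m n) :
    Matrix (Fin m) (Fin n) ℝ × (Fin m → ℝ) × (Fin n → ℝ) × Matrix (Fin n) (Fin n) ℝ ×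
      (Fin n → LowerBd) × (Fin n → UpperBd) × (Fin m → ConstraintSense) :=
  (G.A, G.b, G.c, G.Q, G.l, G.u, G.sense)

/-- The space of LCQP-graphs has the subspace topology induced from the product space. -/
instance instTopologicalSpace (m n : ℕ) : TopologicalSpace (LCQPGraph m n) :=
  TopologicalSpace.induced toProd inferInstance

/-- The space of LCQP-graphs has the Borel σ-algebra. -/
instance instMeasurableSpace (m n : ℕ) : MeasurableSpace (LCQPGraph m n) := borel _

instance instBorelSpace (m n : ℕ) : BorelSpace (LCQPGraph m n) := ⟨rfl⟩

/-- The feasible set `{x ∈ ℝⁿ : A x ∘ b, l ≤ x ≤ u}`. -/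
def feasibleSet {m n : ℕ} (G : LCQPGraph m n) : Set (Fin n → ℝ) :=
  {x | (∀ i, (G.sense i).Holds ((G.A.mulVec x) i) (G.b i)) ∧
    (∀ j, LowerBd.Holds (G.l j) (x j)) ∧ (∀ j, UpperBd.Holds (G.u j) (x j))}

/-- The objective function `½ xᵀ Q x + cᵀ x`. -/
noncomputable def objective {m n : ℕ} (G : LCQPGraph m n) (x : Fin n → ℝ) : ℝ :=
  (1 / 2 : ℝ) * dotProduct x (G.Q.mulVec x) + dotProduct G.c x

/-- The optimal objective value `Φ_obj(G) ∈ ℝ ∪ {±∞}`: the infimum of the objective over the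
feasible set. It is `+∞` if the problem is infeasible and `-∞` if it is unbounded. -/
noncomputable def optValue {m n : ℕ} (G : LCQPGraph m n) : EReal :=
  ⨅ x ∈ G.feasibleSet, ((G.objective x : ℝ) : EReal)

/-- The set of LCQP-graphs whose optimal objective value is a real number. -/
def finiteOptValue (m n : ℕ) : Set (LCQPGraph m n) :=
  {G | G.optValue ∈ Set.range (fun r : ℝ => (r : EReal))}

end LCQPGraph

/-- The embedding and the message-passing layers of a graph neural network, as a stack which starts
with the embedding mappings `f₀ⱽ, f₀ᵂ` and to which `L` message-passing layers (any `L ∈ ℕ`) are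
added one at a time. All mappings are continuous, and none depends on the size of the input graph.
The indices are the dimensions of the current features of constraint and variable nodes. -/
inductive GNNLayers : ℕ → ℕ → Type
  | embed {dV dW : ℕ}
      (fV : C(ℝ × ConstraintSense, Fin dV → ℝ))
      (fW : C(ℝ × LowerBd × UpperBd, Fin dW → ℝ)) :
      GNNLayers dV dW
  | layer {dV dW pV pW pQ eV eW : ℕ} (prev : GNNLayers dV dW)
      (gV : C(Fin dV → ℝ, Fin pV → ℝ))
      (gW : C(Fin dW → ℝ, Fin pW → ℝ))
      (gQ : C(Fin dW → ℝ, Fin pQ → ℝ))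
      (fV : C((Fin dV → ℝ) × (Fin pW → ℝ), Fin eV → ℝ))
      (fW : C((Fin dW → ℝ) × (Fin pV → ℝ) × (Fin pQ → ℝ), Fin eW → ℝ)) :
      GNNLayers eV eW

/-- The node features `(s, t)` of constraint nodes and variable nodes after all layers of a stack.
Embedding: `sᵢ = fⱽ(bᵢ, ∘ᵢ)`, `tⱼ = fᵂ(cⱼ, lⱼ, uⱼ)`. Layer: `sᵢ ← fⱽ(sᵢ, ∑ⱼ Aᵢⱼ gᵂ(tⱼ))` and
`tⱼ ← fᵂ(tⱼ, ∑ᵢ Aᵢⱼ gⱽ(sᵢ), ∑ⱼ' Qⱼⱼ' gᵠ(tⱼ'))`. -/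
noncomputable def GNNLayers.features {m n : ℕ} (G : LCQPGraph m n) :
    {dV dW : ℕ} → GNNLayers dV dW → (Fin m → Fin dV → ℝ) × (Fin n → Fin dW → ℝ)
  | _, _, .embed fV fW =>
      (fun i => fV (G.b i, G.sense i), fun j => fW (G.c j, G.l j, G.u j))
  | _, _, .layer prev gV gW gQ fV fW =>
      let s := (GNNLayers.features G prev).1
      let t := (GNNLayers.features G prev).2
      (fun i => fV (s i, ∑ j, G.A i j • gW (t j)),
       fun j => fW (t j, ∑ i, G.A i j • gV (s i), ∑ j', G.Q j j' • gQ (t j')))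

/-- A message-passing graph neural network with graph-level output: embedding, message-passing
layers, and a continuous output mapping `r₁`. -/
structure GNN : Type where
  {dV dW : ℕ}
  layers : GNNLayers dV dW
  r : C((Fin dV → ℝ) × (Fin dW → ℝ), ℝ)

/-- The output `y = r₁(∑ᵢ sᵢ, ∑ⱼ tⱼ)` of the network on an LCQP-graph. -/
noncomputable def GNN.eval {m n : ℕ} (F : GNN) (G : LCQPGraph m n) : ℝ :=
  F.r (∑ i, (F.layers.features G).1 i, ∑ j, (F.layers.features G).2 j)

/-!
The two claims are instances of one statement: a measurable function of LCQP-graphs which takes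
equal values at any two graphs that no network distinguishes is approximated in probability by
networks (`LCQPGraph.exists_gnn_near_in_measure`). It is applied to the indicator of
`finiteOptValue` and to the real value of `optValue`.

*Approximation.* The space of graphs is Polish, so by Lusin's theorem the function is continuous on
a compact set of almost full measure. Networks can be run in parallel
(`GNNLayers.exists_parallel`), hence their values form an algebra of functions. On the quotient of
the compact set by the relation "no network distinguishes" this algebra separates points, and the
Stone-Weierstrass theorem applies (`LCQPGraph.exists_gnn_near_of_isCompact`).

*Separation.* Suppose that no network distinguishes `G` from `G'`. Some stack of layers
distinguishes every pair of nodes that can be distinguished at all (`GNNLayers.exists_finest`).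
Colour the nodes by its features. One more layer cannot refine these colours, and a continuous
function may take any values on the finitely many features that occur; so nodes of equal colour
have equal weight sums into each colour class, and each colour occurs equally often in both graphs
(`LCQPGraph.exists_indistinguishable`). Now average a feasible point of `G` over colour classes and
transport the averages to `G'`. The constraints are preserved, and as `Q` is positive semidefinite
the objective does not increase (`objective_colorAverage_le`). By symmetry the optimal values agree,
be they finite or not.

*Measurability.* A graph has optimal value below `a` iff for some rational `q < a` it has a feasible
point of objective at most `q`. These pairs of a graph and a point form a closed set, and its
projection is a countable union of closed sets since `ℝⁿ` is `σ`-compact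
(`LCQPGraph.measurable_optValue`).
-/

/-! ### Networks in parallel -/

/-- Concatenation of feature vectors. -/
def appendMap (d e : ℕ) : C((Fin d → ℝ) × (Fin e → ℝ), Fin (d + e) → ℝ) :=
  ⟨fun x => Fin.append x.1 x.2, (Fin.appendIsometry d e).continuous⟩

/-- The first block of a concatenated feature vector. -/
def leftBlock (d e : ℕ) : C(Fin (d + e) → ℝ, Fin d → ℝ) :=
  ⟨fun x i => x (Fin.castAdd e i), by fun_prop⟩

/-- The second block of a concatenated feature vector. -/
def rightBlock (d e : ℕ) : C(Fin (d + e) → ℝ, Fin e → ℝ) :=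
  ⟨fun x i => x (Fin.natAdd d i), by fun_prop⟩

@[simp] theorem appendMap_apply {d e : ℕ} (x : (Fin d → ℝ) × (Fin e → ℝ)) :
    appendMap d e x = Fin.append x.1 x.2 := rfl

@[simp] theorem leftBlock_append {d e : ℕ} (x : Fin d → ℝ) (y : Fin e → ℝ) :
    leftBlock d e (Fin.append x y) = x := by
  ext i; simp [leftBlock]

@[simp] theorem rightBlock_append {d e : ℕ} (x : Fin d → ℝ) (y : Fin e → ℝ) :
    rightBlock d e (Fin.append x y) = y := by
  ext i; simp [rightBlock]

theorem leftBlock_sum {ι : Type*} (s : Finset ι) {d e : ℕ} (x : ι → Fin (d + e) → ℝ) :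
    leftBlock d e (∑ i ∈ s, x i) = ∑ i ∈ s, leftBlock d e (x i) := by
  ext k; simp [leftBlock]

theorem rightBlock_sum {ι : Type*} (s : Finset ι) {d e : ℕ} (x : ι → Fin (d + e) → ℝ) :
    rightBlock d e (∑ i ∈ s, x i) = ∑ i ∈ s, rightBlock d e (x i) := by
  ext k; simp [rightBlock]

namespace GNNLayers

/-- Two stacks can be run in parallel. The depths may differ: the layers of the two stacks are
applied one after the other, each acting on its own block and copying the other block. -/
theorem exists_parallel {dV dW eV eW : ℕ} (a : GNNLayers dV dW) (b : GNNLayers eV eW) :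
    ∃ p : GNNLayers (dV + eV) (dW + eW), ∀ {m n : ℕ} (G : LCQPGraph m n),
      (∀ i, (p.features G).1 i = Fin.append ((a.features G).1 i) ((b.features G).1 i)) ∧
      (∀ j, (p.features G).2 j = Fin.append ((a.features G).2 j) ((b.features G).2 j)) := by
  induction b with
  | @embed eV eW fV' fW' =>
    induction a with
    | embed fV fW =>
      exact ⟨.embed ((appendMap _ _).comp (fV.prodMk fV')) ((appendMap _ _).comp (fW.prodMk fW')),
        fun G => ⟨fun i => rfl, fun j => rfl⟩⟩
    | @layer dV dW pV pW pQ hV hW prev gV gW gQ fV fW ih =>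
      obtain ⟨p, hp⟩ := ih
      refine ⟨.layer p (gV.comp (leftBlock dV eV)) (gW.comp (leftBlock dW eW))
        (gQ.comp (leftBlock dW eW))
        ⟨fun x => appendMap _ _ (fV (leftBlock _ _ x.1, x.2), rightBlock dV eV x.1), by fun_prop⟩
        ⟨fun x => appendMap _ _ (fW (leftBlock _ _ x.1, x.2), rightBlock dW eW x.1), by fun_prop⟩,
        fun G => ⟨fun i => ?_, fun j => ?_⟩⟩ <;>
      simp [features, hp G]
  | @layer eV eW pV pW pQ hV hW prev gV gW gQ fV fW ih =>
    obtain ⟨p, hp⟩ := ih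
    refine ⟨.layer p (gV.comp (rightBlock dV eV)) (gW.comp (rightBlock dW eW))
      (gQ.comp (rightBlock dW eW))
      ⟨fun x => appendMap _ _ (leftBlock dV eV x.1, fV (rightBlock _ _ x.1, x.2)), by fun_prop⟩
      ⟨fun x => appendMap _ _ (leftBlock dW eW x.1, fW (rightBlock _ _ x.1, x.2)), by fun_prop⟩,
      fun G => ⟨fun i => ?_, fun j => ?_⟩⟩ <;>
    simp [features, hp G]

end GNNLayers

/-! ### Continuity of network values, and operations on networks -/

namespace LCQPGraph
variable {m n : ℕ}

theorem continuous_toProd : Continuous (toProd (m := m) (n := n)) := continuous_induced_dom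

theorem continuous_A : Continuous (LCQPGraph.A (m := m) (n := n)) :=
  continuous_fst.comp continuous_toProd

theorem continuous_b : Continuous (LCQPGraph.b (m := m) (n := n)) :=
  (continuous_fst.comp continuous_snd).comp continuous_toProd

theorem continuous_c : Continuous (LCQPGraph.c (m := m) (n := n)) :=
  (continuous_fst.comp (continuous_snd.comp continuous_snd)).comp continuous_toProd

theorem continuous_Q : Continuous (LCQPGraph.Q (m := m) (n := n)) :=
  (continuous_fst.comp (continuous_snd.comp (continuous_snd.comp continuous_snd))).comp
    continuous_toProd

theorem continuous_l : Continuous (LCQPGraph.l (m := m) (n := n)) :=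
  (continuous_fst.comp (continuous_snd.comp (continuous_snd.comp (continuous_snd.comp
    continuous_snd)))).comp continuous_toProd

theorem continuous_u : Continuous (LCQPGraph.u (m := m) (n := n)) :=
  (continuous_fst.comp (continuous_snd.comp (continuous_snd.comp (continuous_snd.comp
    (continuous_snd.comp continuous_snd))))).comp continuous_toProd

theorem continuous_sense : Continuous (LCQPGraph.sense (m := m) (n := n)) :=
  (continuous_snd.comp (continuous_snd.comp (continuous_snd.comp (continuous_snd.comp
    (continuous_snd.comp continuous_snd))))).comp continuous_toProd

end LCQPGraph

section
variable {m n : ℕ}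
open LCQPGraph

theorem GNNLayers.continuous_features {dV dW : ℕ} (a : GNNLayers dV dW) :
    (∀ i, Continuous fun G : LCQPGraph m n => (a.features G).1 i) ∧
      (∀ j, Continuous fun G : LCQPGraph m n => (a.features G).2 j) := by
  have hA : ∀ i j, Continuous fun G : LCQPGraph m n => G.A i j :=
    fun i j => continuous_A.matrix_elem i j
  have hQ : ∀ i j, Continuous fun G : LCQPGraph m n => G.Q i j :=
    fun i j => continuous_Q.matrix_elem i j
  induction a with
  | embed fV fW =>
    refine ⟨fun i => ?_, fun j => ?_⟩
    · exact fV.continuous.comp (((continuous_apply i).comp continuous_b).prodMk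
        ((continuous_apply i).comp continuous_sense))
    · exact fW.continuous.comp (((continuous_apply j).comp continuous_c).prodMk
        (((continuous_apply j).comp continuous_l).prodMk ((continuous_apply j).comp continuous_u)))
  | layer prev gV gW gQ fV fW ih =>
    obtain ⟨hs, ht⟩ := ih
    refine ⟨fun i => ?_, fun j => ?_⟩
    · exact fV.continuous.comp ((hs i).prodMk (continuous_finsetSum _ fun j _ =>
        (hA i j).smul (gW.continuous.comp (ht j))))
    · exact fW.continuous.comp ((ht j).prodMk ((continuous_finsetSum _ fun i _ =>
        (hA i j).smul (gV.continuous.comp (hs i))).prodMk (continuous_finsetSum _ fun k _ =>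
        (hQ j k).smul (gQ.continuous.comp (ht k)))))

theorem GNN.continuous_eval (F : GNN) : Continuous fun G : LCQPGraph m n => F.eval G :=
  F.r.continuous.comp ((continuous_finsetSum _ fun i _ => F.layers.continuous_features.1 i).prodMk
    (continuous_finsetSum _ fun j _ => F.layers.continuous_features.2 j))

/-- Networks can be combined by any continuous binary operation. -/
theorem GNN.exists_combine (op : C(ℝ × ℝ, ℝ)) (F F' : GNN) :
    ∃ H : GNN, ∀ {m n : ℕ} (G : LCQPGraph m n), H.eval G = op (F.eval G, F'.eval G) := by
  obtain ⟨p, hp⟩ := F.layers.exists_parallel F'.layers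
  refine ⟨⟨p, ⟨fun x => op (F.r (leftBlock _ _ x.1, leftBlock _ _ x.2),
    F'.r (rightBlock _ _ x.1, rightBlock _ _ x.2)), by fun_prop⟩⟩, fun G => ?_⟩
  simp [GNN.eval, leftBlock_sum, rightBlock_sum, hp G]

theorem GNN.exists_const (r : ℝ) :
    ∃ H : GNN, ∀ {m n : ℕ} (G : LCQPGraph m n), H.eval G = r :=
  ⟨⟨.embed (dV := 0) (dW := 0) (.const _ 0) (.const _ 0), .const _ r⟩, fun _ => rfl⟩

end

/-! ### Averaging over colour classes -/

theorem ConstraintSense.convex_holds (σ : ConstraintSense) (b : ℝ) :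
    Convex ℝ {a | σ.Holds a b} := by
  cases σ
  · exact convex_Iic b
  · exact convex_singleton b
  · exact convex_Ici b

theorem LowerBd.convex_holds (l : LowerBd) : Convex ℝ {x | l.Holds x} := by
  cases l
  · exact convex_Ici _
  · exact convex_univ

theorem UpperBd.convex_holds (u : UpperBd) : Convex ℝ {x | UpperBd.Holds u x} := by
  cases u
  · exact convex_Iic _
  · exact convex_univ

theorem Convex.mem_of_card_mul_eq_sum {ι : Type*} {S : Set ℝ} (hS : Convex ℝ S) {I : Finset ι}
    (hI : I.Nonempty) {z : ι → ℝ} (hz : ∀ i ∈ I, z i ∈ S) {y : ℝ}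
    (hy : (I.card : ℝ) * y = ∑ i ∈ I, z i) : y ∈ S := by
  have hpos : (0 : ℝ) < I.card := by exact_mod_cast hI.card_pos
  have h := hS.sum_mem (t := I) (w := fun _ => (I.card : ℝ)⁻¹) (z := z)
    (fun _ _ => by positivity) (by simp [hpos.ne']) hz
  have : y = ∑ i ∈ I, (I.card : ℝ)⁻¹ • z i := by
    simp only [smul_eq_mul]
    rw [← Finset.mul_sum, ← hy]; field_simp
  rwa [this]

section
variable {ι ι' κ : Type*} [Fintype ι] [Fintype ι']

open Classical in
/-- The average of `x` over the nodes of colour `γ`, and `0` if there is none. -/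
noncomputable def colorAverage (t : ι → κ) (x : ι → ℝ) (γ : κ) : ℝ :=
  (∑ j with t j = γ, x j) / (Finset.univ.filter fun j => t j = γ).card

open Classical in
theorem card_mul_colorAverage (t : ι → κ) (x : ι → ℝ) (γ : κ) :
    ((Finset.univ.filter fun j => t j = γ).card : ℝ) * colorAverage t x γ =
      ∑ j with t j = γ, x j := by
  rcases (Finset.univ.filter fun j => t j = γ).eq_empty_or_nonempty with h | h
  · simp [h]
  · have : ((Finset.univ.filter fun j => t j = γ).card : ℝ) ≠ 0 := by
      exact_mod_cast h.card_pos.ne'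
    rw [colorAverage]; field_simp

/-- Averaging over colour classes is orthogonal projection onto class functions: it does not
change the pairing with a class function. -/
theorem sum_mul_colorAverage (t : ι → κ) (x w : ι → ℝ) (hw : ∀ j k, t j = t k → w j = w k) :
    ∑ j, w j * colorAverage t x (t j) = ∑ j, w j * x j := by
  classical
  have key : ∀ γ, ∑ j with t j = γ, w j * colorAverage t x (t j) = ∑ j with t j = γ, w j * x j := by
    intro γ
    rcases (Finset.univ.filter fun j => t j = γ).eq_empty_or_nonempty with h | ⟨k, hk⟩
    · simp [h]
    · have hk : t k = γ := by simpa using hk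
      trans ∑ j with t j = γ, w k * colorAverage t x γ
      · refine Finset.sum_congr rfl fun j hj => ?_
        have hj : t j = γ := by simpa using hj
        rw [hw j k (hj.trans hk.symm), hj]
      · rw [Finset.sum_const, nsmul_eq_mul, mul_left_comm, card_mul_colorAverage, Finset.mul_sum]
        refine Finset.sum_congr rfl fun j hj => ?_
        have hj : t j = γ := by simpa using hj
        rw [hw j k (hj.trans hk.symm)]
  have hm : ∀ j ∈ (Finset.univ : Finset ι), t j ∈ Finset.univ.image t :=
    fun j _ => Finset.mem_image_of_mem _ (Finset.mem_univ _)
  rw [← Finset.sum_fiberwise_of_maps_to hm, ← Finset.sum_fiberwise_of_maps_to hm]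
  exact Finset.sum_congr rfl fun γ _ => key γ

/-- Two colourings use every colour equally often, expressed by sums of functions of the
colours. -/
def SameColorCounts (t : ι → κ) (t' : ι' → κ) : Prop :=
  ∀ h : κ → ℝ, ∑ j, h (t j) = ∑ j, h (t' j)

theorem SameColorCounts.symm {t : ι → κ} {t' : ι' → κ} (H : SameColorCounts t t') :
    SameColorCounts t' t := fun h => (H h).symm

theorem SameColorCounts.exists_eq {t : ι → κ} {t' : ι' → κ} (H : SameColorCounts t t') (j' : ι') :
    ∃ j, t j = t' j' := by
  classical
  by_contra! hne
  have h := H fun γ => if γ = t' j' then 1 else 0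
  simp only [hne, if_false, Finset.sum_const_zero] at h
  have h1 : (1 : ℝ) ≤ ∑ j, if t' j = t' j' then (1 : ℝ) else 0 := by
    have := Finset.single_le_sum (f := fun j => if t' j = t' j' then (1 : ℝ) else 0)
      (fun j _ => by positivity) (Finset.mem_univ j')
    simpa using this
  linarith

theorem SameColorCounts.sum_eq {t : ι → κ} {t' : ι' → κ} (H : SameColorCounts t t')
    {w : ι → ℝ} {w' : ι' → ℝ} (hw : ∀ j j', t j = t' j' → w j = w' j') :
    ∑ j, w j = ∑ j', w' j' := by
  have hw' : ∀ i j, t' i = t' j → w' i = w' j := by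
    intro i j hij
    obtain ⟨k, hk⟩ := H.exists_eq i
    rw [← hw k i hk, hw k j (hk.trans hij)]
  have e' : ∀ j', w' j' = Function.extend t' w' 0 (t' j') := by
    intro j'
    rw [Function.FactorsThrough.extend_apply (fun a b h => hw' a b h)]
  have e : ∀ j, w j = Function.extend t' w' 0 (t j) := by
    intro j
    obtain ⟨j', hj'⟩ := H.symm.exists_eq j
    rw [hw j j' hj'.symm, e' j', hj']
  simp_rw [e, e']
  exact H _

end

/-! ### Graphs which colour refinement does not distinguish -/

namespace LCQPGraph
variable {m n : ℕ}

/-- Colourings of the nodes of two graphs which colour refinement (the Weisfeiler-Leman test)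
cannot refine further and which do not distinguish the two graphs: every colour occurs equally
often in both graphs, and nodes of the same colour have the same input feature and, for each colour,
the same total weight of edges into the nodes of that colour (stated by pairing with functions `h`
of the colours). -/
structure Indistinguishable {κ μ : Type*} (G G' : LCQPGraph m n) (s s' : Fin m → κ)
    (t t' : Fin n → μ) : Prop where
  constraint_counts : SameColorCounts s s'
  variable_counts : SameColorCounts t t'
  constraint_feature : ∀ i i', s i = s' i' → G.b i = G'.b i' ∧ G.sense i = G'.sense i'
  variable_feature : ∀ j j', t j = t' j' → G.c j = G'.c j' ∧ G.l j = G'.l j' ∧ G.u j = G'.u j'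
  row_sum : ∀ i i', s i = s' i' → ∀ h : μ → ℝ,
    ∑ j, G.A i j * h (t j) = ∑ j, G'.A i' j * h (t' j)
  col_sum : ∀ j j', t j = t' j' → ∀ h : κ → ℝ,
    ∑ i, G.A i j * h (s i) = ∑ i, G'.A i j' * h (s' i)
  quad_sum : ∀ j j', t j = t' j' → ∀ h : μ → ℝ,
    ∑ k, G.Q j k * h (t k) = ∑ k, G'.Q j' k * h (t' k)

namespace Indistinguishable
variable {κ μ : Type*} {G G' : LCQPGraph m n} {s s' : Fin m → κ} {t t' : Fin n → μ}

theorem symm (H : Indistinguishable G G' s s' t t') : Indistinguishable G' G s' s t' t where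
  constraint_counts := H.constraint_counts.symm
  variable_counts := H.variable_counts.symm
  constraint_feature i i' h := by
    have := H.constraint_feature i' i h.symm
    exact ⟨this.1.symm, this.2.symm⟩
  variable_feature j j' h := by
    have := H.variable_feature j' j h.symm
    exact ⟨this.1.symm, this.2.1.symm, this.2.2.symm⟩
  row_sum i i' h f := (H.row_sum i' i h.symm f).symm
  col_sum i i' h f := (H.col_sum i' i h.symm f).symm
  quad_sum i i' h f := (H.quad_sum i' i h.symm f).symm

/-- Averaging a feasible point over colour classes gives a feasible point of the other graph. -/
theorem colorAverage_mem_feasibleSet (H : Indistinguishable G G' s s' t t') {x : Fin n → ℝ}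
    (hx : x ∈ G.feasibleSet) : (fun j => colorAverage t x (t' j)) ∈ G'.feasibleSet := by
  classical
  obtain ⟨hA, hl, hu⟩ := hx
  refine ⟨fun i' => ?_, fun j' => ?_, fun j' => ?_⟩
  · obtain ⟨i₀, hi₀⟩ := H.constraint_counts.exists_eq i'
    refine ((G'.sense i').convex_holds (G'.b i')).mem_of_card_mul_eq_sum
      (I := Finset.univ.filter fun i => s i = s' i') (z := fun i => G.A.mulVec x i)
      ⟨i₀, by simpa using hi₀⟩ (fun i hi => ?_) ?_
    · have h := H.constraint_feature i i' (by simpa using hi)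
      simpa [← h.1, ← h.2] using hA i
    · -- Double counting of the block of `A` formed by the class of `i'` and the class of `j`.
      have hw : ∀ j k, t j = t k →
          ∑ i with s i = s' i', G.A i j = ∑ i with s i = s' i', G.A i k := by
        intro j k hjk
        obtain ⟨j', hj'⟩ := H.variable_counts.symm.exists_eq j
        have h1 := H.col_sum j j' hj'.symm fun γ => if γ = s' i' then 1 else 0
        have h2 := H.col_sum k j' (hjk.symm.trans hj'.symm) fun γ => if γ = s' i' then 1 else 0
        simpa [Finset.sum_filter] using h1.trans h2.symm
      calc _ = ∑ i with s i = s' i', ∑ j, G.A i j * colorAverage t x (t j) := by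
            rw [← nsmul_eq_mul, ← Finset.sum_const]
            refine Finset.sum_congr rfl fun i hi => ?_
            exact (H.row_sum i i' (by simpa using hi) (colorAverage t x)).symm
        _ = ∑ j, (∑ i with s i = s' i', G.A i j) * colorAverage t x (t j) := by
            rw [Finset.sum_comm]; simp_rw [Finset.sum_mul]
        _ = ∑ j, (∑ i with s i = s' i', G.A i j) * x j := sum_mul_colorAverage _ _ _ hw
        _ = _ := by simp_rw [Finset.sum_mul]; rw [Finset.sum_comm]; rfl
  · obtain ⟨j₀, hj₀⟩ := H.variable_counts.exists_eq j'
    refine (LowerBd.convex_holds (G'.l j')).mem_of_card_mul_eq_sum (z := x)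
      (I := Finset.univ.filter fun j => t j = t' j') ⟨j₀, by simpa using hj₀⟩ (fun j hj => ?_)
      (card_mul_colorAverage t x (t' j'))
    have h := H.variable_feature j j' (by simpa using hj)
    simpa [← h.2.1] using hl j
  · obtain ⟨j₀, hj₀⟩ := H.variable_counts.exists_eq j'
    refine (UpperBd.convex_holds (G'.u j')).mem_of_card_mul_eq_sum (z := x)
      (I := Finset.univ.filter fun j => t j = t' j') ⟨j₀, by simpa using hj₀⟩ (fun j hj => ?_)
      (card_mul_colorAverage t x (t' j'))
    have h := H.variable_feature j j' (by simpa using hj)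
    simpa [← h.2.2] using hu j

/-- Averaging over colour classes does not increase the objective, by convexity. -/
theorem objective_colorAverage_le (H : Indistinguishable G G' s s' t t') (x : Fin n → ℝ) :
    G'.objective (fun j => colorAverage t x (t' j)) ≤ G.objective x := by
  set a : Fin n → ℝ := fun j => colorAverage t x (t j) with ha
  -- The objective of the averaged point can be computed in either graph.
  have hlin : dotProduct G'.c (fun j => colorAverage t x (t' j)) = dotProduct G.c x := by
    have hc : ∀ j k, t j = t k → G.c j = G.c k := by
      intro j k hjk
      obtain ⟨j', hj'⟩ := H.variable_counts.symm.exists_eq j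
      rw [(H.variable_feature j j' hj'.symm).1,
        (H.variable_feature k j' (hjk.symm.trans hj'.symm)).1]
    calc _ = ∑ j, G.c j * colorAverage t x (t j) :=
          (H.variable_counts.sum_eq fun j j' h => by
            rw [(H.variable_feature j j' h).1, h]).symm
      _ = _ := sum_mul_colorAverage _ _ _ hc
  have hquad : dotProduct (fun j => colorAverage t x (t' j))
      (G'.Q.mulVec fun j => colorAverage t x (t' j)) = dotProduct a (G.Q.mulVec a) := by
    refine (H.variable_counts.sum_eq fun j j' h => ?_).symm
    rw [ha]
    simp only [Matrix.mulVec, dotProduct]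
    rw [H.quad_sum j j' h, h]
  have hproj : dotProduct x (G.Q.mulVec a) = dotProduct a (G.Q.mulVec a) := by
    have hw : ∀ j k, t j = t k → G.Q.mulVec a j = G.Q.mulVec a k := by
      intro j k hjk
      obtain ⟨j', hj'⟩ := H.variable_counts.symm.exists_eq j
      exact (H.quad_sum j j' hj'.symm (colorAverage t x)).trans
        (H.quad_sum k j' (hjk.symm.trans hj'.symm) (colorAverage t x)).symm
    rw [dotProduct_comm x, dotProduct_comm a]
    exact (sum_mul_colorAverage t x _ hw).symm
  have hsymm : dotProduct a (G.Q.mulVec x) = dotProduct x (G.Q.mulVec a) := by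
    have hT : G.Q.IsSymm := by simpa using G.posSemidef.1
    rw [Matrix.dotProduct_mulVec, ← Matrix.mulVec_transpose, hT.eq, dotProduct_comm]
  have hpos : 0 ≤ dotProduct (x - a) (G.Q.mulVec (x - a)) := by
    simpa using G.posSemidef.dotProduct_mulVec_nonneg (x - a)
  rw [Matrix.mulVec_sub, dotProduct_sub, sub_dotProduct, sub_dotProduct] at hpos
  rw [objective, objective, hlin, hquad]
  linarith

theorem optValue_le (H : Indistinguishable G G' s s' t t') : G'.optValue ≤ G.optValue := by
  refine le_iInf₂ fun x hx => ?_
  refine (iInf₂_le _ (H.colorAverage_mem_feasibleSet hx)).trans ?_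
  exact_mod_cast H.objective_colorAverage_le x

theorem optValue_eq (H : Indistinguishable G G' s s' t t') : G.optValue = G'.optValue :=
  le_antisymm H.symm.optValue_le H.optValue_le

end Indistinguishable
end LCQPGraph

/-! ### Networks distinguish graphs of different optimal value -/

/-- Any prescription of values on a finite set extends to a continuous function. -/
theorem exists_continuousMap_eqOn_finite {X : Type*} [TopologicalSpace X] [T4Space X] {S : Set X}
    (hS : S.Finite) (h : X → ℝ) : ∃ g : C(X, ℝ), ∀ x ∈ S, g x = h x := by
  have := hS.to_subtype
  obtain ⟨g, hg⟩ := ContinuousMap.exists_restrict_eq hS.isClosed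
    (⟨fun x => h x, continuous_of_discreteTopology⟩ : C(S, ℝ))
  exact ⟨g, fun x hx => DFunLike.congr_fun hg ⟨x, hx⟩⟩

/-- An injective numerical encoding of the constraint types. -/
def ConstraintSense.code : ConstraintSense → ℝ
  | .le => 0
  | .eq => 1
  | .ge => 2

theorem ConstraintSense.code_injective : Function.Injective ConstraintSense.code := by
  intro σ τ h
  cases σ <;> cases τ <;> simp_all [code]

/-- A continuous injective encoding of a bound, finite or not: an indicator of finiteness and the
value, which is set to `0` for an infinite bound. -/
def boundCode : C(ℝ ⊕ Unit, ℝ × ℝ) :=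
  ⟨Sum.elim (fun a => (1, a)) fun _ => (0, 0), by fun_prop⟩

theorem boundCode_injective : Function.Injective boundCode := by
  rintro (a | a) (b | b) h <;> simp_all [boundCode]

namespace GNNLayers
variable {m n : ℕ}

/-- The embedding layer which records the input features faithfully. -/
noncomputable def faithful : GNNLayers 2 5 :=
  .embed ⟨fun x => ![x.1, x.2.code], by
      have : Continuous ConstraintSense.code := continuous_of_discreteTopology
      fun_prop⟩
    ⟨fun x => ![x.1, (boundCode x.2.1).1, (boundCode x.2.1).2, (boundCode x.2.2).1,
      (boundCode x.2.2).2], by fun_prop⟩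

theorem eq_of_faithful_fst {G G' : LCQPGraph m n} {i i' : Fin m}
    (h : (faithful.features G).1 i = (faithful.features G').1 i') :
    G.b i = G'.b i' ∧ G.sense i = G'.sense i' := by
  refine ⟨congrFun h 0, ConstraintSense.code_injective (congrFun h 1)⟩

theorem eq_of_faithful_snd {G G' : LCQPGraph m n} {j j' : Fin n}
    (h : (faithful.features G).2 j = (faithful.features G').2 j') :
    G.c j = G'.c j' ∧ G.l j = G'.l j' ∧ G.u j = G'.u j' :=
  ⟨congrFun h 0, boundCode_injective (Prod.ext (congrFun h 1) (congrFun h 2)),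
    boundCode_injective (Prod.ext (congrFun h 3) (congrFun h 4))⟩

/-- For two given graphs there is a stack which distinguishes all the pairs of nodes that some
stack distinguishes. Such a stack minimizes the number of pairs of nodes with equal features: if
another stack distinguished one more pair, so would the two stacks run in parallel. -/
theorem exists_finest (G G' : LCQPGraph m n) :
    ∃ (dV dW : ℕ) (a : GNNLayers dV dW), ∀ (eV eW : ℕ) (b : GNNLayers eV eW),
      (∀ i i', (a.features G).1 i = (a.features G').1 i' →
        (b.features G).1 i = (b.features G').1 i') ∧
      (∀ j j', (a.features G).2 j = (a.features G').2 j' →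
        (b.features G).2 j = (b.features G').2 j') := by
  classical
  let E (dV dW : ℕ) (a : GNNLayers dV dW) : Finset ((Fin m × Fin m) ⊕ (Fin n × Fin n)) :=
    Finset.univ.filter fun p => Sum.elim
      (fun p => (a.features G).1 p.1 = (a.features G').1 p.2)
      (fun p => (a.features G).2 p.1 = (a.features G').2 p.2) p
  let N (x : Σ dV dW : ℕ, GNNLayers dV dW) : ℕ := (E x.1 x.2.1 x.2.2).card
  obtain ⟨⟨dV, dW, a⟩, -, hmin⟩ :=
    (InvImage.wf N Nat.lt_wfRel.wf).has_min Set.univ ⟨⟨2, 5, faithful⟩, trivial⟩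
  refine ⟨dV, dW, a, fun eV eW b => ?_⟩
  obtain ⟨p, hp⟩ := a.exists_parallel b
  have hsub : E _ _ p ⊆ E _ _ a := by
    rintro (q | q) hq
    · have := congrArg (leftBlock dV eV) (Finset.mem_filter.1 hq).2
      simp only [hp G, hp G', leftBlock_append] at this
      exact Finset.mem_filter.2 ⟨Finset.mem_univ _, this⟩
    · have := congrArg (leftBlock dW eW) (Finset.mem_filter.1 hq).2
      simp only [hp G, hp G', leftBlock_append] at this
      exact Finset.mem_filter.2 ⟨Finset.mem_univ _, this⟩
  have heq : E _ _ p = E _ _ a :=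
    Finset.eq_of_subset_of_card_le hsub (not_lt.1 (hmin ⟨_, _, p⟩ trivial))
  refine ⟨fun i i' h => ?_, fun j j' h => ?_⟩
  · have hm : Sum.inl (i, i') ∈ E _ _ p := heq ▸ Finset.mem_filter.2 ⟨Finset.mem_univ _, h⟩
    have := congrArg (rightBlock dV eV) (Finset.mem_filter.1 hm).2
    simpa only [hp G, hp G', rightBlock_append] using this
  · have hm : Sum.inr (j, j') ∈ E _ _ p := heq ▸ Finset.mem_filter.2 ⟨Finset.mem_univ _, h⟩
    have := congrArg (rightBlock dW eW) (Finset.mem_filter.1 hm).2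
    simpa only [hp G, hp G', rightBlock_append] using this

end GNNLayers

namespace LCQPGraph
variable {m n : ℕ}

/-- If no network distinguishes two graphs, then their nodes, coloured by the features of a finest
stack, are indistinguishable to colour refinement. -/
theorem exists_indistinguishable {G G' : LCQPGraph m n} (h : ∀ F : GNN, F.eval G = F.eval G') :
    ∃ (dV dW : ℕ) (a : GNNLayers dV dW), Indistinguishable G G' (a.features G).1 (a.features G').1
      (a.features G).2 (a.features G').2 := by
  obtain ⟨dV, dW, a, ha⟩ := GNNLayers.exists_finest G G'
  -- Functions of the features may be taken continuous, as only finitely many values occur.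
  have hV : ∀ f : (Fin dV → ℝ) → ℝ, ∃ g : C(Fin dV → ℝ, ℝ),
      (∀ i, g ((a.features G).1 i) = f ((a.features G).1 i)) ∧
      (∀ i, g ((a.features G').1 i) = f ((a.features G').1 i)) := by
    intro f
    obtain ⟨g, hg⟩ := exists_continuousMap_eqOn_finite
      ((Set.finite_range (a.features G).1).union (Set.finite_range (a.features G').1)) f
    exact ⟨g, fun i => hg _ (.inl ⟨i, rfl⟩), fun i => hg _ (.inr ⟨i, rfl⟩)⟩
  have hW : ∀ f : (Fin dW → ℝ) → ℝ, ∃ g : C(Fin dW → ℝ, ℝ),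
      (∀ i, g ((a.features G).2 i) = f ((a.features G).2 i)) ∧
      (∀ i, g ((a.features G').2 i) = f ((a.features G').2 i)) := by
    intro f
    obtain ⟨g, hg⟩ := exists_continuousMap_eqOn_finite
      ((Set.finite_range (a.features G).2).union (Set.finite_range (a.features G').2)) f
    exact ⟨g, fun i => hg _ (.inl ⟨i, rfl⟩), fun i => hg _ (.inr ⟨i, rfl⟩)⟩
  refine ⟨dV, dW, a, ?_, ?_, ?_, ?_, ?_, ?_, ?_⟩
  · intro f
    obtain ⟨g, hg, hg'⟩ := hV f
    have := h ⟨.layer a (pV := 0) (pW := 0) (pQ := 0) (eV := 1) (eW := 0) (.const _ 0) (.const _ 0)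
      (.const _ 0) ⟨fun x _ => g x.1, by fun_prop⟩ (.const _ 0), ⟨fun x => x.1 0, by fun_prop⟩⟩
    simpa [GNN.eval, GNNLayers.features, hg, hg'] using this
  · intro f
    obtain ⟨g, hg, hg'⟩ := hW f
    have := h ⟨.layer a (pV := 0) (pW := 0) (pQ := 0) (eV := 0) (eW := 1) (.const _ 0) (.const _ 0)
      (.const _ 0) (.const _ 0) ⟨fun x _ => g x.1, by fun_prop⟩, ⟨fun x => x.2 0, by fun_prop⟩⟩
    simpa [GNN.eval, GNNLayers.features, hg, hg'] using this
  · exact fun i i' hi => GNNLayers.eq_of_faithful_fst ((ha _ _ .faithful).1 i i' hi)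
  · exact fun j j' hj => GNNLayers.eq_of_faithful_snd ((ha _ _ .faithful).2 j j' hj)
  · intro i i' hi f
    obtain ⟨g, hg, hg'⟩ := hW f
    have := congrFun ((ha _ _ (.layer a (pV := 0) (pW := 1) (pQ := 0) (eV := 1) (eW := 0)
      (.const _ 0) ⟨fun x _ => g x, by fun_prop⟩ (.const _ 0) ⟨fun x => x.2, by fun_prop⟩
      (.const _ 0))).1 i i' hi) 0
    simpa [GNNLayers.features, hg, hg'] using this
  · intro j j' hj f
    obtain ⟨g, hg, hg'⟩ := hV f
    have := congrFun ((ha _ _ (.layer a (pV := 1) (pW := 0) (pQ := 0) (eV := 0) (eW := 1)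
      ⟨fun x _ => g x, by fun_prop⟩ (.const _ 0) (.const _ 0) (.const _ 0)
      ⟨fun x => x.2.1, by fun_prop⟩)).2 j j' hj) 0
    simpa [GNNLayers.features, hg, hg'] using this
  · intro j j' hj f
    obtain ⟨g, hg, hg'⟩ := hW f
    have := congrFun ((ha _ _ (.layer a (pV := 0) (pW := 0) (pQ := 1) (eV := 0) (eW := 1)
      (.const _ 0) (.const _ 0) ⟨fun x _ => g x, by fun_prop⟩ (.const _ 0)
      ⟨fun x => x.2.2, by fun_prop⟩)).2 j j' hj) 0
    simpa [GNNLayers.features, hg, hg'] using this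

theorem optValue_eq_of_eval_eq {G G' : LCQPGraph m n} (h : ∀ F : GNN, F.eval G = F.eval G') :
    G.optValue = G'.optValue := by
  obtain ⟨_, _, _, H⟩ := exists_indistinguishable h
  exact H.optValue_eq

end LCQPGraph

/-! ### Lusin's theorem -/

/-- **Lusin's theorem**: a measurable function into a second countable space is continuous on a
compact set whose complement has small measure. -/
theorem Measurable.exists_isCompact_continuousOn {X Y : Type*} [TopologicalSpace X] [T2Space X]
    [MeasurableSpace X] {μ : Measure X} [IsFiniteMeasure μ]
    [μ.InnerRegularCompactLTTop] [OpensMeasurableSpace X]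
    [TopologicalSpace Y] [SecondCountableTopology Y] [MeasurableSpace Y]
    [OpensMeasurableSpace Y] {f : X → Y} (hf : Measurable f) {ε : ENNReal} (hε : ε ≠ 0) :
    ∃ K, IsCompact K ∧ μ Kᶜ < ε ∧ ContinuousOn f K := by
  obtain ⟨δ, hδ, hsum⟩ := ENNReal.exists_pos_sum_of_countable' hε
    (Option (TopologicalSpace.countableBasis Y))
  -- For each basic open set `U`, remove a small set so that the preimage of `U` becomes
  -- relatively open in the rest.
  have key : ∀ U : Option (TopologicalSpace.countableBasis Y), ∃ J, IsCompact J ∧ μ Jᶜ ≤ δ U ∧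
      ∀ B, U = some B → ∃ V, IsOpen V ∧ ∀ x ∈ J, x ∈ V ↔ f x ∈ B.1 := by
    rintro (_ | ⟨U, hU⟩)
    · obtain ⟨J, -, hJ, hμ⟩ := MeasurableSet.univ.exists_isCompact_sdiff_lt (measure_ne_top μ _)
        (hδ none).ne'
      exact ⟨J, hJ, by simpa [Set.compl_eq_univ_sdiff] using hμ.le, by simp⟩
    · have hm : MeasurableSet (f ⁻¹' U) :=
        hf (TopologicalSpace.isOpen_of_mem_countableBasis hU).measurableSet
      have h2 := (ENNReal.half_pos (hδ (some ⟨U, hU⟩)).ne').ne'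
      obtain ⟨J, hJU, hJ, hμ⟩ := hm.exists_isCompact_sdiff_lt (measure_ne_top μ _) h2
      obtain ⟨J', hJU', hJ', hμ'⟩ := hm.compl.exists_isCompact_sdiff_lt (measure_ne_top μ _) h2
      refine ⟨J ∪ J', hJ.union hJ', ?_, ?_⟩
      · have : (J ∪ J')ᶜ ⊆ (f ⁻¹' U \ J) ∪ ((f ⁻¹' U)ᶜ \ J') := by
          intro x hx
          by_cases hxU : x ∈ f ⁻¹' U
          · exact .inl ⟨hxU, fun h => hx (.inl h)⟩
          · exact .inr ⟨hxU, fun h => hx (.inr h)⟩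
        refine (measure_mono this).trans ((measure_union_le _ _).trans ?_)
        exact (add_le_add hμ.le hμ'.le).trans (ENNReal.add_halves _).le
      · rintro B hB
        obtain rfl := Option.some.inj hB
        refine ⟨J'ᶜ, hJ'.isClosed.isOpen_compl, ?_⟩
        rintro x (hx | hx)
        · exact ⟨fun _ => hJU hx, fun h h' => hJU' h' h⟩
        · exact ⟨fun h => absurd hx h, fun h => absurd h (hJU' hx)⟩
  choose J hJ hμ hV using key
  refine ⟨⋂ U, J U, (hJ none).of_isClosed_subset
    (isClosed_iInter fun U => (hJ U).isClosed) (Set.iInter_subset J none), ?_, ?_⟩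
  · rw [Set.compl_iInter]
    exact (measure_iUnion_le _).trans_lt ((ENNReal.tsum_le_tsum hμ).trans_lt hsum)
  · rw [continuousOn_iff_continuous_domRestrict]
    refine (TopologicalSpace.isBasis_countableBasis Y).continuous_iff.2 fun U hU => ?_
    obtain ⟨V, hVo, hV⟩ := hV (some ⟨U, hU⟩) ⟨U, hU⟩ rfl
    convert! hVo.preimage (continuous_subtype_val (p := fun x => x ∈ ⋂ U, J U)) using 1
    ext x
    exact (hV x (Set.mem_iInter.1 x.2 _)).symm

/-! ### Density of networks -/

namespace LCQPGraph
variable {m n : ℕ}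

theorem isClosedEmbedding_toProd : Topology.IsClosedEmbedding (toProd (m := m) (n := n)) := by
  refine ⟨⟨⟨rfl⟩, ?_⟩, ?_⟩
  · rintro ⟨⟩ ⟨⟩ h
    simpa [toProd] using h
  · have : Set.range (toProd (m := m) (n := n)) = {p | p.2.2.2.1.IsHermitian} ∩
        ⋂ x : Fin n → ℝ, {p | 0 ≤ dotProduct (star x) (p.2.2.2.1.mulVec x)} := by
      ext p
      constructor
      · rintro ⟨G, rfl⟩
        exact ⟨G.posSemidef.1, Set.mem_iInter.2 fun x => G.posSemidef.dotProduct_mulVec_nonneg x⟩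
      · rintro ⟨h1, h2⟩
        exact ⟨⟨p.1, p.2.1, p.2.2.1, p.2.2.2.1, p.2.2.2.2.1, p.2.2.2.2.2.1, p.2.2.2.2.2.2,
          .of_dotProduct_mulVec_nonneg h1 fun x => Set.mem_iInter.1 h2 x⟩, rfl⟩
    rw [this]
    have hQ : Continuous fun p : Matrix (Fin m) (Fin n) ℝ × (Fin m → ℝ) × (Fin n → ℝ) ×
        Matrix (Fin n) (Fin n) ℝ × (Fin n → LowerBd) × (Fin n → UpperBd) ×
        (Fin m → ConstraintSense) => p.2.2.2.1 := by fun_prop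
    refine IsClosed.inter (isClosed_eq hQ.matrix_conjTranspose hQ) (isClosed_iInter fun x => ?_)
    exact isClosed_le continuous_const
      (continuous_const.dotProduct (hQ.matrix_mulVec continuous_const))

instance : Finite ConstraintSense :=
  Finite.of_injective (fun σ => (σ.rec 0 1 2 : Fin 3)) fun σ τ h => by
    cases σ <;> cases τ <;> simp_all

instance : PolishSpace (LCQPGraph m n) := by
  have : PolishSpace (Matrix (Fin m) (Fin n) ℝ) := inferInstanceAs (PolishSpace (Fin m → Fin n → ℝ))
  have : PolishSpace (Matrix (Fin n) (Fin n) ℝ) := inferInstanceAs (PolishSpace (Fin n → Fin n → ℝ))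
  have : PolishSpace ConstraintSense := inferInstance
  have : PolishSpace (ℝ ⊕ Unit) := inferInstance
  exact isClosedEmbedding_toProd.polishSpace

/-- On a compact set, networks approximate uniformly every continuous function that takes equal
values at graphs which no network distinguishes. -/
theorem exists_gnn_near_of_isCompact {K : Set (LCQPGraph m n)} (hK : IsCompact K)
    {f : LCQPGraph m n → ℝ} (hf : ContinuousOn f K)
    (hinv : ∀ G G', (∀ F : GNN, F.eval G = F.eval G') → f G = f G') {δ : ℝ} (hδ : 0 < δ) :
    ∃ F : GNN, ∀ G ∈ K, |F.eval G - f G| < δ := by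
  have : CompactSpace K := isCompact_iff_compactSpace.1 hK
  let S : Setoid K := ⟨fun x y => ∀ F : GNN, F.eval x.1 = F.eval y.1,
    ⟨fun _ _ => rfl, fun h F => (h F).symm, fun h h' F => (h F).trans (h' F)⟩⟩
  have hF : ∀ F : GNN, Continuous fun x : K => F.eval x.1 :=
    fun F => F.continuous_eval.comp continuous_subtype_val
  let ev (F : GNN) : C(Quotient S, ℝ) :=
    ⟨Quotient.lift (fun x : K => F.eval x.1) fun _ _ h => h F, (hF F).quotient_lift _⟩
  let φ : C(Quotient S, ℝ) := ⟨Quotient.lift (fun x : K => f x.1) fun _ _ h => hinv _ _ h,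
    (continuousOn_iff_continuous_domRestrict.1 hf).quotient_lift _⟩
  let 𝒜 : Subalgebra ℝ C(Quotient S, ℝ) :=
    { carrier := Set.range ev
      mul_mem' := by
        rintro _ _ ⟨F, rfl⟩ ⟨F', rfl⟩
        obtain ⟨H, hH⟩ := GNN.exists_combine ⟨fun x => x.1 * x.2, by fun_prop⟩ F F'
        refine ⟨H, ContinuousMap.ext fun q => ?_⟩
        induction q using Quotient.inductionOn with
        | h x => exact hH x.1
      add_mem' := by
        rintro _ _ ⟨F, rfl⟩ ⟨F', rfl⟩
        obtain ⟨H, hH⟩ := GNN.exists_combine ⟨fun x => x.1 + x.2, by fun_prop⟩ F F'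
        refine ⟨H, ContinuousMap.ext fun q => ?_⟩
        induction q using Quotient.inductionOn with
        | h x => exact hH x.1
      algebraMap_mem' := by
        intro r
        obtain ⟨H, hH⟩ := GNN.exists_const r
        refine ⟨H, ContinuousMap.ext fun q => ?_⟩
        induction q using Quotient.inductionOn with
        | h x => exact hH x.1 }
  have hsep : 𝒜.SeparatesPoints := by
    intro p q hpq
    induction p using Quotient.inductionOn with | h x => ?_
    induction q using Quotient.inductionOn with | h y => ?_
    by_contra! hne
    exact hpq (Quotient.sound fun F => hne (ev F) ⟨ev F, ⟨F, rfl⟩, rfl⟩)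
  obtain ⟨⟨_, F, rfl⟩, hg⟩ :=
    ContinuousMap.exists_mem_subalgebra_near_continuous_of_separatesPoints 𝒜 hsep φ φ.continuous δ hδ
  exact ⟨F, fun G hG => hg (Quotient.mk S ⟨G, hG⟩)⟩

/-- Networks approximate in probability every measurable function which takes equal values at
graphs that no network distinguishes. -/
theorem exists_gnn_near_in_measure (P : Measure (LCQPGraph m n)) [IsFiniteMeasure P]
    {f : LCQPGraph m n → ℝ} (hf : Measurable f)
    (hinv : ∀ G G', (∀ F : GNN, F.eval G = F.eval G') → f G = f G') {ε : ENNReal} (hε : ε ≠ 0)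
    {δ : ℝ} (hδ : 0 < δ) : ∃ F : GNN, P {G | δ ≤ |F.eval G - f G|} < ε := by
  obtain ⟨K, hK, hP, hc⟩ := hf.exists_isCompact_continuousOn (μ := P) hε
  obtain ⟨F, hF⟩ := exists_gnn_near_of_isCompact hK hc hinv hδ
  exact ⟨F, (measure_mono fun G hG hGK => (hF G hGK).not_ge hG).trans_lt hP⟩

/-! ### Measurability of the optimal value -/

theorem isClosed_setOf_feasible_objective_le (q : ℝ) :
    IsClosed {p : LCQPGraph m n × (Fin n → ℝ) |
      p.2 ∈ p.1.feasibleSet ∧ p.1.objective p.2 ≤ q} := by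
  have hA := (continuous_A (m := m) (n := n)).comp (continuous_fst (Y := Fin n → ℝ))
  have hQ := (continuous_Q (m := m) (n := n)).comp (continuous_fst (Y := Fin n → ℝ))
  have hc := (continuous_c (m := m) (n := n)).comp (continuous_fst (Y := Fin n → ℝ))
  have hb := (continuous_b (m := m) (n := n)).comp (continuous_fst (Y := Fin n → ℝ))
  have hl := (continuous_l (m := m) (n := n)).comp (continuous_fst (Y := Fin n → ℝ))
  have hu := (continuous_u (m := m) (n := n)).comp (continuous_fst (Y := Fin n → ℝ))
  have hs := (continuous_sense (m := m) (n := n)).comp (continuous_fst (Y := Fin n → ℝ))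
  have hsense : IsClosed {p : ConstraintSense × ℝ × ℝ | p.1.Holds p.2.1 p.2.2} := by
    have : {p : ConstraintSense × ℝ × ℝ | p.1.Holds p.2.1 p.2.2} =
        ({p | p.1 = .le} ∩ {p | p.2.1 ≤ p.2.2}) ∪ (({p | p.1 = .eq} ∩ {p | p.2.1 = p.2.2}) ∪
          ({p | p.1 = .ge} ∩ {p | p.2.2 ≤ p.2.1})) := by
      ext ⟨σ, a, b⟩
      cases σ <;> simp [ConstraintSense.Holds]
    rw [this]
    have h1 := continuous_snd (X := ConstraintSense) (Y := ℝ × ℝ)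
    exact ((isClosed_eq continuous_fst continuous_const).inter (isClosed_le h1.fst h1.snd)).union
      (((isClosed_eq continuous_fst continuous_const).inter (isClosed_eq h1.fst h1.snd)).union
      ((isClosed_eq continuous_fst continuous_const).inter (isClosed_le h1.snd h1.fst)))
  have hlower : IsClosed {p : LowerBd × ℝ | p.1.Holds p.2} := by
    rw [← isOpen_compl_iff]
    have : {p : LowerBd × ℝ | p.1.Holds p.2}ᶜ =
        Prod.map (Sum.inl : ℝ → LowerBd) id '' {p | p.2 < p.1} := by
      ext ⟨l | l, x⟩ <;> simp [LowerBd.Holds]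
    rw [this]
    exact (isOpenMap_inl.prodMap IsOpenMap.id) _ (isOpen_lt continuous_snd continuous_fst)
  have hupper : IsClosed {p : UpperBd × ℝ | UpperBd.Holds p.1 p.2} := by
    rw [← isOpen_compl_iff]
    have : {p : UpperBd × ℝ | UpperBd.Holds p.1 p.2}ᶜ =
        Prod.map (Sum.inl : ℝ → UpperBd) id '' {p | p.1 < p.2} := by
      ext ⟨l | l, x⟩ <;> simp [UpperBd.Holds]
    rw [this]
    exact (isOpenMap_inl.prodMap IsOpenMap.id) _ (isOpen_lt continuous_fst continuous_snd)
  have : {p : LCQPGraph m n × (Fin n → ℝ) | p.2 ∈ p.1.feasibleSet ∧ p.1.objective p.2 ≤ q} =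
      ((⋂ i, {p | (p.1.sense i).Holds (p.1.A.mulVec p.2 i) (p.1.b i)}) ∩
        ((⋂ j, {p | (p.1.l j).Holds (p.2 j)}) ∩ ⋂ j, {p | UpperBd.Holds (p.1.u j) (p.2 j)})) ∩
        {p | p.1.objective p.2 ≤ q} := by
    ext p
    simp [feasibleSet]
  rw [this]
  refine IsClosed.inter (IsClosed.inter ?_ (IsClosed.inter ?_ ?_)) ?_
  · exact isClosed_iInter fun i => hsense.preimage (((continuous_apply i).comp hs).prodMk
      (((continuous_apply i).comp (hA.matrix_mulVec continuous_snd)).prodMk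
        ((continuous_apply i).comp hb)))
  · exact isClosed_iInter fun j => hlower.preimage (((continuous_apply j).comp hl).prodMk
      ((continuous_apply j).comp continuous_snd))
  · exact isClosed_iInter fun j => hupper.preimage (((continuous_apply j).comp hu).prodMk
      ((continuous_apply j).comp continuous_snd))
  · exact isClosed_le ((continuous_const.mul (continuous_snd.dotProduct
      (hQ.matrix_mulVec continuous_snd))).add (hc.dotProduct continuous_snd)) continuous_const

/-- The set of graphs having a feasible point of objective at most `q` is an `F_σ` set: the feasible
points of norm at most `k` contribute the projection of a closed set along a compact factor. -/
theorem measurableSet_exists_feasible_objective_le (q : ℝ) :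
    MeasurableSet {G : LCQPGraph m n | ∃ x ∈ G.feasibleSet, G.objective x ≤ q} := by
  have : {G : LCQPGraph m n | ∃ x ∈ G.feasibleSet, G.objective x ≤ q} =
      ⋃ k : ℕ, Prod.fst '' {p : LCQPGraph m n × Metric.closedBall (0 : Fin n → ℝ) k |
        p.2.1 ∈ p.1.feasibleSet ∧ p.1.objective p.2.1 ≤ q} := by
    ext G
    simp only [Set.mem_ofPred_eq, Set.mem_iUnion, Set.mem_image, Prod.exists]
    constructor
    · rintro ⟨x, hx⟩
      obtain ⟨k, hk⟩ := exists_nat_ge ‖x‖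
      exact ⟨k, G, ⟨x, by simpa using hk⟩, hx, rfl⟩
    · rintro ⟨k, _, x, hx, rfl⟩
      exact ⟨x, hx⟩
  rw [this]
  refine MeasurableSet.iUnion fun k => IsClosed.measurableSet ?_
  have : CompactSpace (Metric.closedBall (0 : Fin n → ℝ) k) :=
    isCompact_iff_compactSpace.1 (isCompact_closedBall _ _)
  exact isClosedMap_fst_of_compactSpace _ ((isClosed_setOf_feasible_objective_le q).preimage
    (continuous_fst.prodMk (continuous_subtype_val.comp continuous_snd)))

theorem measurable_optValue : Measurable (optValue (m := m) (n := n)) := by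
  refine measurable_of_Iio fun a => ?_
  have : optValue (m := m) (n := n) ⁻¹' Set.Iio a = ⋃ (q : ℚ) (_ : ((q : ℝ) : EReal) < a),
      {G | ∃ x ∈ G.feasibleSet, G.objective x ≤ (q : ℝ)} := by
    ext G
    simp only [Set.mem_preimage, Set.mem_Iio, optValue, iInf_lt_iff, Set.mem_iUnion,
      Set.mem_ofPred_eq, exists_prop]
    constructor
    · rintro ⟨x, hx, h⟩
      obtain ⟨q, h1, h2⟩ := EReal.lt_iff_exists_rat_btwn.1 h
      exact ⟨q, h2, x, hx, (EReal.coe_lt_coe_iff.1 h1).le⟩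
    · rintro ⟨q, hq, x, hx, h⟩
      exact ⟨x, hx, (EReal.coe_le_coe_iff.2 h).trans_lt hq⟩
  rw [this]
  exact MeasurableSet.iUnion fun q => MeasurableSet.iUnion fun _ =>
    measurableSet_exists_feasible_objective_le _

theorem measurableSet_finiteOptValue : MeasurableSet (finiteOptValue m n) :=
  measurable_optValue EReal.measurableEmbedding_coe.measurableSet_range

end LCQPGraph

theorem theorem3p2 (m n : ℕ) (P : Measure (LCQPGraph m n)) [IsProbabilityMeasure P] :
    (∀ ε : ℝ, 0 < ε → ∃ F₁ : GNN,
      P {G | Set.indicator {G' : LCQPGraph m n | F₁.eval G' > 1 / 2} (fun _ => (1 : ℝ)) G ≠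
          Set.indicator (LCQPGraph.finiteOptValue m n) (fun _ => (1 : ℝ)) G} < ENNReal.ofReal ε) ∧
    (P (LCQPGraph.finiteOptValue m n) = 1 →
      ∀ ε δ : ℝ, 0 < ε → 0 < δ → ∃ F₂ : GNN,
        P {G | ((F₂.eval G : EReal) - G.optValue).abs > ENNReal.ofReal δ} < ENNReal.ofReal ε) := by
  classical
  constructor
  · intro ε hε
    -- A value within `1/2` of the indicator lies on the same side of `1/2` as the indicator.
    obtain ⟨F, hF⟩ := LCQPGraph.exists_gnn_near_in_measure P
      (f := (LCQPGraph.finiteOptValue m n).indicator fun _ => (1 : ℝ))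
      (measurable_const.indicator LCQPGraph.measurableSet_finiteOptValue)
      (fun G G' h => by
        have : G ∈ LCQPGraph.finiteOptValue m n ↔ G' ∈ LCQPGraph.finiteOptValue m n := by
          simp only [LCQPGraph.finiteOptValue, Set.mem_ofPred_eq,
            LCQPGraph.optValue_eq_of_eval_eq h]
        simp only [Set.indicator_apply, this])
      (ENNReal.ofReal_pos.2 hε).ne' (δ := 1 / 2) (by norm_num)
    refine ⟨F, (measure_mono fun G hG => ?_).trans_lt hF⟩
    contrapose! hG
    simp only [Set.mem_ofPred_eq, not_le, abs_lt, not_not, Set.indicator_apply] at hG ⊢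
    split_ifs at hG ⊢ <;> first | rfl | (exfalso; linarith)
  · intro hP ε δ hε hδ
    obtain ⟨F, hF⟩ := LCQPGraph.exists_gnn_near_in_measure P
      (f := fun G => G.optValue.toReal) (LCQPGraph.measurable_optValue.ereal_toReal)
      (fun G G' h => by simp only [LCQPGraph.optValue_eq_of_eval_eq h])
      (ENNReal.ofReal_pos.2 hε).ne' hδ
    refine ⟨F, lt_of_le_of_lt (measure_mono_ae ?_) hF⟩
    -- Almost surely the optimal value is real, so `toReal` loses nothing.
    have hae : ∀ᵐ G ∂P, G ∈ LCQPGraph.finiteOptValue m n :=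
      (prob_compl_eq_zero_iff LCQPGraph.measurableSet_finiteOptValue).2 hP
    filter_upwards [hae] with G hG hdev
    obtain ⟨r, hr⟩ := hG
    have hdev : ((F.eval G : EReal) - G.optValue).abs > ENNReal.ofReal δ := hdev
    change δ ≤ |F.eval G - G.optValue.toReal|
    rw [← hr] at hdev ⊢
    simp only [← EReal.coe_sub, EReal.abs_def, gt_iff_lt] at hdev
    rw [EReal.toReal_coe]
    exact ((ENNReal.ofReal_lt_ofReal_iff_of_nonneg hδ.le).1 hdev).le
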